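/- **Notation.** Let $n\ge 2$. Let $\Delta^{(n)}=\{p\in\mathbb R^n: p_i>0 \text{ for all } i,\ \sum_i p_i=1\}$ be the open unit simplex with the Euclidean metric, $\overline{\Delta^{(n)}}$ its closure, $T\Delta^{(n)}=\{v\in\mathbb R^n:\sum_i v_i=0\}$, and $m$ the surface measure ($(n-1)$-dimensional Lebesgue measure) on $\Delta^{(n)}$. A *portfolio* is a Borel map $\pi:\Delta^{(n)}\to\overline{\Delta^{(n)}}$; $\frac{\pi(p)}{p}$ denotes the vector with components $\pi_i(p)/p_i$. Let $\mathcal{FG}$ be the set of pairs $(\pi,\Phi)$ where $\pi$ is a portfolio and $\Phi:\Delta^{(n)}\to(0,\infty)$ is a concave function generating it, i.e. $$1+\Big\langle \tfrac{\pi(p)}{p},q-p\Big\rangle\ \ge\ \frac{\Phi(q)}{\Phi(p)}\qquad\text{for all }p,q\in\Delta^{(n)}.$$ The L-divergence of $(\pi,\Phi)\in\mathcal{FG}$ is $$T(q\mid p)=\log\Big(1+\Big\langle \tfrac{\pi(p)}{p},q-p\Big\rangle\Big)-\log\frac{\Phi(q)}{\Phi(p)}.$$ For a Borel probability measure $\mathbb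 P$ on $\Delta^{(n)}\times\Delta^{(n)}$, $(\pi,\Phi)\in\mathcal{FG}$ is called *optimal for $\mathbb P$* if it maximizes $\int T(q\mid p)\,\mathrm d\mathbb P(p,q)$ over $\mathcal{FG}$. We call $\mathbb P$ *absolutely continuous* if $\mathbb P\ll m\otimes m$, and *discrete* if it is carried by a countable set. **Theorem.** Let $K\subset\Delta^{(n)}$ be compact, and let $\mathbb P$ be an absolutely continuous Borel probability measure on $\Delta^{(n)}\times\Delta^{(n)}$ supported on $K\times K$. Write $\mathbb P(\mathrm dp\,\mathrm dq)=\mathbb P_1(\mathrm dp)\,\mathbb P_2(\mathrm dq\mid p)$, where $\mathbb P_1(\mathrm dp)=f(p)\,m(\mathrm dp)$ is the first marginal and $\mathbb P_2(\cdot\mid p)$ is the conditional distribution of the second variable given $p$. Suppose that $\mathbb P$ satisfies the *support condition*: for $m$-almost all $p$ with $f(p)>0$, for every $v\in T\Delta^{(n)}$ there exists $\lambda>0$ such that $p+\lambda v$ belongs to the support of $\mathbb P_2(\cdot\mid p)$. Let $(\pi,\Phi)$ be optimal for $\mathbb P$. Let $(\mathbb P_N)_{N\ge1}$ be Borel probability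 measures on $\Delta^{(n)}\times\Delta^{(n)}$ supported on $K\times K$, each of them discrete or absolutely continuous, with $\mathbb P_N\to\mathbb P$ weakly, and let $(\widehat\pi^{(N)},\widehat\Phi^{(N)})$ be optimal for $\mathbb P_N$, for each $N\ge1$. Then $$\widehat\pi^{(N)}(p)\longrightarrow\pi(p)\qquad\text{for $m$-almost every $p$ with } f(p)>0 .$$ -/

import Mathlib

open MeasureTheory ProbabilityTheory Filter Topology
open scoped ENNReal

/-- The open unit simplex `Δ⁽ⁿ⁾` in Euclidean space `ℝⁿ`. -/
def openSimplex (n : ℕ) : Set (EuclideanSpace ℝ (Fin n)) :=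
  {p | (∀ i, 0 < p i) ∧ ∑ i, p i = 1}

/-- The closed unit simplex, i.e. the closure of `Δ⁽ⁿ⁾`. -/
def closedSimplex (n : ℕ) : Set (EuclideanSpace ℝ (Fin n)) :=
  {p | (∀ i, 0 ≤ p i) ∧ ∑ i, p i = 1}

/-- The surface measure `m` of `Δ⁽ⁿ⁾`: its `(n-1)`-dimensional Hausdorff measure, in the
normalization that agrees with Lebesgue measure on `(n-1)`-dimensional Euclidean spaces. -/
noncomputable def surfaceMeasure (n : ℕ) : Measure (openSimplex n) :=
  Measure.euclideanHausdorffMeasure (n - 1)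

/-- A portfolio: a Borel measurable map from the open to the closed simplex. -/
def IsPortfolio {n : ℕ} (π : openSimplex n → EuclideanSpace ℝ (Fin n)) : Prop :=
  Measurable π ∧ ∀ p, π p ∈ closedSimplex n

/-- `⟨π(p) / p, q - p⟩`, with the weight ratio `π(p) / p` taken componentwise. -/
noncomputable def weightRatioInner {n : ℕ} (π : openSimplex n → EuclideanSpace ℝ (Fin n))
    (p q : openSimplex n) : ℝ :=
  ∑ i, π p i / (p : EuclideanSpace ℝ (Fin n)) i *
    ((q : EuclideanSpace ℝ (Fin n)) i - (p : EuclideanSpace ℝ (Fin n)) i)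

/-- The pair `(π, Φ)` is a functionally generated portfolio: `π` is a portfolio, `Φ` is a positive
concave function on `Δ⁽ⁿ⁾`, and `Φ` generates `π`. The function `Φ` is written on the ambient
space so that concavity makes sense; its values outside `Δ⁽ⁿ⁾` play no role. -/
structure IsFunctionallyGenerated {n : ℕ} (π : openSimplex n → EuclideanSpace ℝ (Fin n))
    (Φ : EuclideanSpace ℝ (Fin n) → ℝ) : Prop where
  isPortfolio : IsPortfolio π
  pos : ∀ p ∈ openSimplex n, 0 < Φ p
  concaveOn : ConcaveOn ℝ (openSimplex n) Φ
  generates : ∀ p q : openSimplex n, Φ q / Φ p ≤ 1 + weightRatioInner π p q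

/-- The L-divergence `T(q | p)` of the pair `(π, Φ)`. -/
noncomputable def LDivergence {n : ℕ} (π : openSimplex n → EuclideanSpace ℝ (Fin n))
    (Φ : EuclideanSpace ℝ (Fin n) → ℝ) (q p : openSimplex n) : ℝ :=
  Real.log (1 + weightRatioInner π p q) - Real.log (Φ q / Φ p)

/-- `(π, Φ)` maximizes `∫ T(q | p) dP` over all functionally generated portfolios. For a `P` that
is supported on `K × K` with `K` compact, as below, each `T` is measurable and `P`-essentially
bounded, so all the integrals are finite. -/
def IsOptimalPortfolio {n : ℕ} (P : Measure (openSimplex n × openSimplex n))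
    (π : openSimplex n → EuclideanSpace ℝ (Fin n)) (Φ : EuclideanSpace ℝ (Fin n) → ℝ) : Prop :=
  IsFunctionallyGenerated π Φ ∧
    ∀ π' Φ', IsFunctionallyGenerated π' Φ' →
      ∫ z, LDivergence π' Φ' z.2 z.1 ∂P ≤ ∫ z, LDivergence π Φ z.2 z.1 ∂P

/-- A discrete measure: carried by a countable set of points. -/
def IsDiscreteMeasure {X : Type*} [MeasurableSpace X] (P : Measure X) : Prop :=
  ∃ S : Set X, S.Countable ∧ P Sᶜ = 0

/-- Absolute continuity of a measure on `Δ⁽ⁿ⁾ × Δ⁽ⁿ⁾` with respect to `m ⊗ m`. -/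
def IsAbsCont {n : ℕ} (P : Measure (openSimplex n × openSimplex n)) : Prop :=
  P ≪ (surfaceMeasure n).prod (surfaceMeasure n)

/-- The support condition, for a first marginal with density `f` with respect to `m` and
conditional distributions `κ p` of the second variable given the first: for `m`-almost all `p`
with `f p > 0`, every tangent vector `v` has some `λ > 0` such that `p + λ v` belongs to the
(topological) support of `κ p`. -/
def SupportCondition {n : ℕ} (f : openSimplex n → ℝ≥0∞)
    (κ : Kernel (openSimplex n) (openSimplex n)) : Prop :=
  ∀ᵐ p ∂(surfaceMeasure n), 0 < f p →
    ∀ v : EuclideanSpace ℝ (Fin n), ∑ i, v i = 0 →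
      ∃ l : ℝ, 0 < l ∧ ∃ q ∈ (κ p).support,
        (q : EuclideanSpace ℝ (Fin n)) = (p : EuclideanSpace ℝ (Fin n)) + l • v

/-! Compete with the geometric mean of two generating functions, whose portfolio is the arithmetic
mean of the two portfolios. By strict concavity of the logarithm, along any subsequence on which the
normalized functions `log ΦN` converge, say to `φ'`, the limit of `πN p / p` and the vector
`π p / p` have the same inner product with `q` for `P`-almost every `(p, q)`. The support condition
then makes `π p` a generator of `φ'` at almost every `p` with `0 < f p`.

The exceptional null set depends on the subsequence. To get rid of this, let `p` be a density point
of `{0 < f}` at which `log Φ` is differentiable, so that `π` is continuous at `p`. Then `p` is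
approached from every tangent direction by points at which `π` generates `φ'`. Since
superdifferentials are antitone, `π p` is the only generator of `φ'` at `p`, hence the only limit
point of `πN p`. -/

section ContinuousConvergence

variable {ι X Y : Type*} [TopologicalSpace X]

lemma tendsto_uncurry_of_equicontinuousAt [UniformSpace Y] {l : Filter ι} {F : ι → X → Y} {x : X}
    {y : Y} (hF : EquicontinuousAt F x) (hy : Tendsto (fun i => F i x) l (𝓝 y)) :
    Tendsto (Function.uncurry F) (l ×ˢ 𝓝 x) (𝓝 y) := by
  refine (hy.comp tendsto_fst).congr_uniformity (tendsto_def.2 fun U hU => ?_)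
  filter_upwards [tendsto_snd.eventually (hF U hU)] with z hz using hz z.1

lemma exists_subseq_tendsto_of_equicontinuous [TopologicalSpace.SeparableSpace X]
    [PseudoMetricSpace Y] [ProperSpace Y] {F : ℕ → X → Y} (hF : Equicontinuous F)
    (hb : ∀ x, Bornology.IsBounded (Set.range fun k => F k x)) :
    ∃ s : ℕ → ℕ, StrictMono s ∧ ∃ f : X → Y, ∀ x, Tendsto (fun k => F (s k) x) atTop (𝓝 (f x)) := by
  obtain ⟨D, hD, hDd⟩ := TopologicalSpace.exists_countable_dense X
  have : Countable D := hD.to_subtype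
  obtain ⟨g, -, s, hs, hg⟩ :=
    (isCompact_univ_pi fun d : D => (hb d).isCompact_closure).tendsto_subseq
      (x := fun k (d : D) => F k d) fun k d _ => subset_closure (Set.mem_range_self k)
  rw [tendsto_pi_nhds] at hg
  refine ⟨s, hs, ?_⟩
  suffices h : ∀ x, CauchySeq fun k => F (s k) x from
    ⟨fun x => (cauchySeq_tendsto_of_complete (h x)).choose,
      fun x => (cauchySeq_tendsto_of_complete (h x)).choose_spec⟩
  refine fun x => Metric.cauchySeq_iff.2 fun ε hε => ?_
  obtain ⟨d, hdx, hdD⟩ := mem_closure_iff_nhds.1 (hDd x) _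
    (Metric.equicontinuousAt_iff_right.1 (hF x) (ε / 3) (by positivity))
  obtain ⟨M, hM⟩ := Metric.cauchySeq_iff.1 (hg ⟨d, hdD⟩).cauchySeq (ε / 3) (by positivity)
  refine ⟨M, fun a ha b hb => ?_⟩
  calc dist (F (s a) x) (F (s b) x)
      ≤ dist (F (s a) x) (F (s a) d) + dist (F (s a) d) (F (s b) d)
        + dist (F (s b) d) (F (s b) x) := dist_triangle4 _ _ _ _
    _ < ε / 3 + ε / 3 + ε / 3 :=
        add_lt_add (add_lt_add (hdx (s a)) (hM a ha b hb)) ((dist_comm _ _).trans_lt (hdx (s b)))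
    _ = ε := add_thirds ε

end ContinuousConvergence

section ExtendedContinuousMapping

variable {X Y : Type*} [TopologicalSpace X] [MeasurableSpace X] [OpensMeasurableSpace X]
  [HasOuterApproxClosed X] {P : ProbabilityMeasure X} {PN : ℕ → ProbabilityMeasure X}

lemma tendsto_map_of_tendsto_uncurry [TopologicalSpace Y] [MeasurableSpace Y]
    [OpensMeasurableSpace Y] (hP : Tendsto PN atTop (𝓝 P)) {h : ℕ → X → Y} {h' : X → Y}
    (hm : ∀ N, AEMeasurable (h N) (PN N)) (hm' : AEMeasurable h' P)
    (hlim : ∀ᵐ x ∂(P : Measure X), Tendsto (Function.uncurry h) (atTop ×ˢ 𝓝 x) (𝓝 (h' x))) :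
    Tendsto (fun N => (PN N).map (hm N)) atTop (𝓝 (P.map hm')) := by
  refine tendsto_of_forall_isOpen_le_liminf_nat' fun G hG => ?_
  let U : ℕ → Set X := fun M => interior (⋂ N ≥ M, h N ⁻¹' G)
  have hUmono : Monotone U := fun M M' hMM' =>
    interior_mono (Set.biInter_subset_biInter_left fun N hN => hMM'.trans hN)
  have hcover : ∀ᵐ x ∂(P : Measure X), x ∈ h' ⁻¹' G → x ∈ ⋃ M, U M := by
    filter_upwards [hlim] with x hx hxG
    obtain ⟨A, hA, V, hV, hAV⟩ :=
      eventually_prod_iff.1 (hx.eventually (hG.mem_nhds hxG))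
    obtain ⟨M, hM⟩ := eventually_atTop.1 hA
    refine Set.mem_iUnion.2 ⟨M, mem_interior_iff_mem_nhds.2 ?_⟩
    filter_upwards [hV] with y hy
    exact Set.mem_iInter₂.2 fun N hN => hAV (hM N hN) hy
  have hU : ∀ M, (P : Measure X) (U M) ≤
      liminf (fun N => ((PN N).map (hm N) : Measure Y) G) atTop := fun M => by
    refine (ProbabilityMeasure.le_liminf_measure_open_of_tendsto hP isOpen_interior).trans
      (liminf_le_liminf ?_)
    filter_upwards [eventually_ge_atTop M] with N hN
    rw [ProbabilityMeasure.map_apply' _ _ hG.measurableSet]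
    exact measure_mono (interior_subset.trans (Set.biInter_subset_of_mem hN))
  rw [ProbabilityMeasure.map_apply' _ _ hG.measurableSet]
  exact (measure_mono_ae hcover).trans
    (le_of_tendsto' (tendsto_measure_iUnion_atTop hUmono) hU)

lemma ae_mem_of_tendsto_of_isClosed (hP : Tendsto PN atTop (𝓝 P)) {F : Set X} (hF : IsClosed F)
    (hPN : ∀ N, ∀ᵐ x ∂(PN N : Measure X), x ∈ F) : ∀ᵐ x ∂(P : Measure X), x ∈ F := by
  refine nonpos_iff_eq_zero.1
    ((ProbabilityMeasure.le_liminf_measure_open_of_tendsto hP hF.isOpen_compl).trans_eq ?_)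
  exact (liminf_congr (Eventually.of_forall hPN)).trans (liminf_const 0)

lemma tendsto_integral_of_tendsto_uncurry (hP : Tendsto PN atTop (𝓝 P)) {h : ℕ → X → ℝ}
    {h' : X → ℝ} (hm : ∀ N, Measurable (h N)) {C : ℝ}
    (hC : ∀ N, ∀ᵐ x ∂(PN N : Measure X), |h N x| ≤ C)
    (hlim : ∀ᵐ x ∂(P : Measure X), Tendsto (Function.uncurry h) (atTop ×ˢ 𝓝 x) (𝓝 (h' x))) :
    Integrable h' (P : Measure X) ∧
      Tendsto (fun N => ∫ x, h N x ∂(PN N : Measure X)) atTop (𝓝 (∫ x, h' x ∂(P : Measure X))) := by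
  have hm' : AEMeasurable h' (P : Measure X) :=
    aemeasurable_of_tendsto_metrizable_ae atTop (fun N => (hm N).aemeasurable) <| by
      filter_upwards [hlim] with x hx using
        hx.comp (tendsto_id.prodMk (tendsto_const_nhds (x := x)))
  have hlaw := tendsto_map_of_tendsto_uncurry hP (fun N => (hm N).aemeasurable) hm' hlim
  have hC' : ∀ᵐ x ∂(P : Measure X), |h' x| ≤ C :=
    ae_of_ae_map hm' <| ae_mem_of_tendsto_of_isClosed hlaw
      (F := {y | |y| ≤ C}) (isClosed_le continuous_abs continuous_const)
      fun N => (ae_map_iff (hm N).aemeasurable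
        (isClosed_le continuous_abs continuous_const).measurableSet).2 (hC N)
  let clip : BoundedContinuousFunction ℝ ℝ :=
    .ofNormedAddCommGroup (fun y => max (-C) (min y C)) (by fun_prop) |C| fun y => by
      grind [Real.norm_eq_abs]
  have integral_clip : ∀ (Q : ProbabilityMeasure X) {g : X → ℝ} (hg : AEMeasurable g Q),
      (∀ᵐ x ∂(Q : Measure X), |g x| ≤ C) →
      ∫ y, clip y ∂(Q.map hg : Measure ℝ) = ∫ x, g x ∂(Q : Measure X) := fun Q g hg hgC => by
    rw [ProbabilityMeasure.toMeasure_map,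
      integral_map hg clip.continuous.aestronglyMeasurable]
    refine integral_congr_ae ?_
    filter_upwards [hgC] with x hx
    exact (congrArg _ (min_eq_left (abs_le.1 hx).2)).trans (max_eq_right (abs_le.1 hx).1)
  refine ⟨Integrable.of_bound hm'.aestronglyMeasurable C hC', ?_⟩
  rw [← integral_clip P hm' hC']
  refine (ProbabilityMeasure.tendsto_iff_forall_integral_tendsto.1 hlaw clip).congr fun N => ?_
  exact integral_clip (PN N) _ (hC N)

end ExtendedContinuousMapping

lemma concaveOn_of_forall_exists_le_add {E : Type*} [AddCommGroup E] [Module ℝ E] {s : Set E}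
    {f : E → ℝ} (hs : Convex ℝ s)
    (h : ∀ z ∈ s, ∃ g : E →ₗ[ℝ] ℝ, ∀ y ∈ s, f y ≤ f z + g (y - z)) : ConcaveOn ℝ s f := by
  refine ⟨hs, fun x hx y hy a b ha hb hab => ?_⟩
  obtain ⟨g, hg⟩ := h _ (hs hx hy ha hb hab)
  have hzero : a * g (x - (a • x + b • y)) + b * g (y - (a • x + b • y)) = 0 := by
    simp only [map_sub, map_add, map_smul, smul_eq_mul]
    linear_combination -(a * g x + b * g y) * hab
  have hx' := mul_le_mul_of_nonneg_left (hg x hx) ha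
  have hy' := mul_le_mul_of_nonneg_left (hg y hy) hb
  simp only [smul_eq_mul]
  linear_combination hx' + hy' + hzero + f (a • x + b • y) * hab

lemma mem_posTangentConeAt_of_forall_exists_dist_le {E : Type*} [NormedAddCommGroup E]
    [NormedSpace ℝ E] {s : Set E} {x v : E}
    (h : ∀ ε > 0, ∃ t : ℝ, 0 < t ∧ t < ε ∧ ∃ y ∈ s, dist y (x + t • v) ≤ t * ε) :
    v ∈ posTangentConeAt s x := by
  choose t ht htε y hys hy using fun k : ℕ => h (1 / (k + 1)) Nat.one_div_pos_of_nat
  have htend := tendsto_one_div_add_atTop_nhds_zero_nat (𝕜 := ℝ)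
  have ht0 : Tendsto t atTop (𝓝 0) := squeeze_zero (fun k => (ht k).le) (fun k => (htε k).le) htend
  have hdir : Tendsto (fun k => (t k)⁻¹ • (y k - x)) atTop (𝓝 v) := by
    refine tendsto_iff_dist_tendsto_zero.2 (squeeze_zero (fun _ => dist_nonneg) (fun k => ?_) htend)
    have hrescale : (t k)⁻¹ • (y k - x) - v = (t k)⁻¹ • (y k - (x + t k • v)) := by
      rw [← sub_sub, smul_sub _ (y k - x), inv_smul_smul₀ (ht k).ne']
    rw [dist_eq_norm, hrescale, norm_smul, norm_inv, Real.norm_of_nonneg (ht k).le,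
      inv_mul_le_iff₀ (ht k), ← dist_eq_norm]
    exact hy k
  refine mem_tangentConeAt_of_seq atTop (fun k => ⟨(t k)⁻¹, inv_nonneg.2 (ht k).le⟩)
    (fun k => y k - x) ?_ (Eventually.of_forall fun k => by simpa using hys k) hdir
  simpa [smul_inv_smul₀ (ht _).ne'] using ht0.smul hdir

section NormedSpace

variable {E : Type*} [NormedAddCommGroup E] [NormedSpace ℝ E] [MeasurableSpace E] [BorelSpace E]

lemma ae_differentiableAt_of_locallyLipschitzOn [FiniteDimensional ℝ E] {F : Type*}
    [NormedAddCommGroup F] [NormedSpace ℝ F] [FiniteDimensional ℝ F] (μ : Measure E)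
    [μ.IsAddHaarMeasure] {f : E → F} {U : Set E} (hU : IsOpen U) (hf : LocallyLipschitzOn U f) :
    ∀ᵐ x ∂μ, x ∈ U → DifferentiableAt ℝ f x := by
  refine measure_null_of_locally_null _ fun x hx => ?_
  obtain ⟨hxU, -⟩ := Classical.not_imp.1 hx
  obtain ⟨C, t, ht, hC⟩ := hf hxU
  rw [hU.nhdsWithin_eq hxU] at ht
  refine ⟨_, inter_mem_nhdsWithin _ (interior_mem_nhds.2 ht), measure_mono_null ?_
    (ae_iff.1 (hC.ae_differentiableWithinAt_of_mem (μ := μ)))⟩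
  exact fun y ⟨hy, hyt⟩ hd => hy fun _ =>
    (hd (interior_subset hyt)).differentiableAt (mem_interior_iff_mem_nhds.1 hyt)

/-- At a density point `x` of `S`, the balls `closedBall (x + t • v) (t * ε)` meet `S` in positive
measure for small `t`, so that every direction `v` is tangent to `S`. -/
lemma ae_restrict_posTangentConeAt_eq_univ [SecondCountableTopology E] (μ : Measure E)
    [IsUnifLocDoublingMeasure μ] [IsLocallyFiniteMeasure μ] (S : Set E) :
    ∀ᵐ x ∂μ.restrict S, ∀ S', μ (S \ S') = 0 → posTangentConeAt S' x = Set.univ := by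
  filter_upwards [ae_all_iff.2 fun k : ℕ =>
    IsUnifLocDoublingMeasure.ae_tendsto_measure_inter_div μ S k] with x hx S' hS'
  refine Set.eq_univ_of_forall fun v => ?_
  refine mem_posTangentConeAt_of_forall_exists_dist_le fun ε hε => ?_
  obtain ⟨k, hk⟩ := exists_nat_ge (‖v‖ / ε)
  have hball : ∀ᶠ t : ℝ in 𝓝[>] 0, x ∈ Metric.closedBall (x + t • v) (k * (t * ε)) :=
    eventually_nhdsWithin_of_forall fun t (ht : 0 < t) => by
      rw [Metric.mem_closedBall, dist_self_add_right, norm_smul, Real.norm_of_nonneg ht.le,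
        mul_left_comm]
      exact mul_le_mul_of_nonneg_left ((div_le_iff₀ hε).1 hk) ht.le
  have hradius : Tendsto (fun t : ℝ => t * ε) (𝓝[>] 0) (𝓝[>] 0) :=
    tendsto_nhdsWithin_iff.2 ⟨((continuous_mul_const ε).tendsto' 0 0 (zero_mul ε)).mono_left
      nhdsWithin_le_nhds, eventually_nhdsWithin_of_forall fun t ht => mul_pos ht hε⟩
  obtain ⟨t, ⟨ht, ht0⟩, htε⟩ := (((hx k _ _ hradius hball).eventually_ne one_ne_zero).and
    self_mem_nhdsWithin).and (nhdsWithin_le_nhds (eventually_lt_nhds hε)) |>.exists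
  refine ⟨t, ht0, htε, ?_⟩
  by_contra! hdisj
  refine ht (ENNReal.div_eq_zero_iff.2 (Or.inl (measure_mono_null ?_ hS')))
  exact fun y hy => ⟨hy.1, fun hyS' => (hdisj y hyS').not_ge hy.2⟩

end NormedSpace

open scoped InnerProductSpace NNReal

section Simplex

variable {n : ℕ} {p q : openSimplex n} {u w w' : EuclideanSpace ℝ (Fin n)} {c ε : ℝ}

lemma isCompact_closedSimplex : IsCompact (closedSimplex n) :=
  (EuclideanSpace.equiv (Fin n) ℝ).toHomeomorph.isCompact_preimage.2
    (isCompact_stdSimplex ℝ (Fin n))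

lemma convex_closedSimplex : Convex ℝ (closedSimplex n) :=
  (convex_stdSimplex ℝ (Fin n)).linear_preimage (EuclideanSpace.equiv (Fin n) ℝ).toLinearMap

lemma convex_openSimplex : Convex ℝ (openSimplex n) := by
  refine fun x hx y hy a b ha hb hab =>
    ⟨fun i => ?_, (convex_closedSimplex (n := n) ⟨fun i => (hx.1 i).le, hx.2⟩
      ⟨fun i => (hy.1 i).le, hy.2⟩ ha hb hab).2⟩
  exact convex_Ioi (0 : ℝ) (hx.1 i) (hy.1 i) ha hb hab

lemma openSimplex_coord_le_one (p : openSimplex n) (i : Fin n) : p.1 i ≤ 1 :=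
  (Finset.single_le_sum (fun j _ => (p.2.1 j).le) (Finset.mem_univ i)).trans_eq p.2.2

/-- The points of the open simplex whose coordinates are at least `ε`. For `ε > 0` these sets
exhaust the open simplex. -/
def truncatedSimplex (n : ℕ) (ε : ℝ) : Set (openSimplex n) := {p | ∀ i, ε ≤ p.1 i}

lemma exists_truncatedSimplex_mem_nhds (p : openSimplex n) :
    ∃ ε > 0, truncatedSimplex n ε ∈ 𝓝 p := by
  have hsmall : ∀ᶠ ε in 𝓝[>] (0 : ℝ), ∀ i, ε < p.1 i :=
    eventually_all.2 fun i => nhdsWithin_le_nhds (eventually_lt_nhds (p.2.1 i))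
  obtain ⟨ε, hε, hε0⟩ := (hsmall.and self_mem_nhdsWithin).exists
  refine ⟨ε, hε0, eventually_all.2 fun i => ?_⟩
  exact (by fun_prop : Continuous fun q : openSimplex n => q.1 i).continuousAt.eventually_const_le
    (hε i)

lemma antitone_truncatedSimplex : Antitone (truncatedSimplex n) :=
  fun _ _ h _ hp i => h.trans (hp i)

lemma exists_subset_truncatedSimplex {K : Set (openSimplex n)} (hK : IsCompact K) :
    ∃ ε > 0, K ⊆ truncatedSimplex n ε := by
  refine hK.induction_on (p := fun K => ∃ ε > 0, K ⊆ truncatedSimplex n ε)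
    ⟨1, one_pos, Set.empty_subset _⟩ (fun _ _ h ⟨ε, hε, h'⟩ => ⟨ε, hε, h.trans h'⟩) ?_ ?_
  · rintro K L ⟨ε, hε, hKε⟩ ⟨δ, hδ, hLδ⟩
    exact ⟨min ε δ, lt_min hε hδ, Set.union_subset
      (hKε.trans (antitone_truncatedSimplex (min_le_left ε δ)))
      (hLδ.trans (antitone_truncatedSimplex (min_le_right ε δ)))⟩
  · intro p _
    obtain ⟨ε, hε, hp⟩ := exists_truncatedSimplex_mem_nhds p
    exact ⟨_, mem_nhdsWithin_of_mem_nhds hp, ε, hε, subset_rfl⟩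

/-- The vector `w / p` of weight ratios, taken componentwise. -/
noncomputable def weightRatio (w p : EuclideanSpace ℝ (Fin n)) : EuclideanSpace ℝ (Fin n) :=
  WithLp.toLp 2 fun i => w i / p i

lemma inner_weightRatio (w p u : EuclideanSpace ℝ (Fin n)) :
    ⟪weightRatio w p, u⟫_ℝ = ∑ i, w i * (u i / p i) := by
  rw [PiLp.inner_apply]
  exact Finset.sum_congr rfl fun i _ => mul_comm_div (w i) (p i) (u i) ▸ mul_comm _ _

lemma weightRatio_convexComb (a b : ℝ) (w w' p : EuclideanSpace ℝ (Fin n)) :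
    weightRatio (a • w + b • w') p = a • weightRatio w p + b • weightRatio w' p := by
  ext i
  simp only [weightRatio, PiLp.add_apply, PiLp.smul_apply, smul_eq_mul]
  ring

lemma continuousAt_weightRatio (w : EuclideanSpace ℝ (Fin n)) (p : openSimplex n) :
    ContinuousAt (fun z : EuclideanSpace ℝ (Fin n) × openSimplex n => weightRatio z.1 z.2) (w, p) :=
  (PiLp.continuous_toLp 2 _).continuousAt.comp <| continuousAt_pi.2 fun i =>
    ContinuousAt.div (by fun_prop) (by fun_prop) (p.2.1 i).ne'

lemma le_inner_weightRatio (hw : w ∈ closedSimplex n) (hu : ∀ i, c * p.1 i ≤ u i) :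
    c ≤ ⟪weightRatio w p, u⟫_ℝ := by
  rw [inner_weightRatio]
  calc c = ∑ i, w i * c := by rw [← Finset.sum_mul, hw.2, one_mul]
    _ ≤ ∑ i, w i * (u i / p.1 i) := Finset.sum_le_sum fun i _ =>
        mul_le_mul_of_nonneg_left ((le_div_iff₀ (p.2.1 i)).2 (hu i)) (hw.1 i)

lemma inner_weightRatio_le (hw : w ∈ closedSimplex n) (hu : ∀ i, u i ≤ c * p.1 i) :
    ⟪weightRatio w p, u⟫_ℝ ≤ c := by
  rw [← neg_le_neg_iff, ← inner_neg_right]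
  exact le_inner_weightRatio hw fun i => by simpa using hu i

lemma inner_weightRatio_self (hw : w ∈ closedSimplex n) : ⟪weightRatio w p, (p : _)⟫_ℝ = 1 :=
  (inner_weightRatio_le hw fun _ => (one_mul _).ge).antisymm
    (le_inner_weightRatio hw fun _ => (one_mul _).le)

lemma le_inner_weightRatio_of_mem_truncatedSimplex (hw : w ∈ closedSimplex n) (hε : 0 < ε)
    (hq : q ∈ truncatedSimplex n ε) : ε ≤ ⟪weightRatio w p, (q : _)⟫_ℝ :=
  le_inner_weightRatio hw fun i =>
    (mul_le_of_le_one_right hε.le (openSimplex_coord_le_one p i)).trans (hq i)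

lemma inner_weightRatio_pos (hw : w ∈ closedSimplex n) : 0 < ⟪weightRatio w p, (q : _)⟫_ℝ := by
  obtain ⟨ε, hε, hq⟩ := exists_truncatedSimplex_mem_nhds q
  exact hε.trans_le (le_inner_weightRatio_of_mem_truncatedSimplex hw hε (mem_of_mem_nhds hq))

lemma inner_weightRatio_le_inv (hw : w ∈ closedSimplex n) (hε : 0 < ε)
    (hp : p ∈ truncatedSimplex n ε) : ⟪weightRatio w p, (q : _)⟫_ℝ ≤ ε⁻¹ :=
  inner_weightRatio_le hw fun i => (openSimplex_coord_le_one q i).trans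
    ((inv_mul_cancel₀ hε.ne').symm.trans_le (by gcongr; exact hp i))

lemma inner_weightRatio_sub_one_le (hw : w ∈ closedSimplex n) (hε : 0 < ε)
    (hp : p ∈ truncatedSimplex n ε) : ⟪weightRatio w p, (q : _)⟫_ℝ - 1 ≤ ε⁻¹ * dist q p := by
  rw [← inner_weightRatio_self hw (p := p), ← inner_sub_right]
  refine inner_weightRatio_le hw fun i => ?_
  calc q.1 i - p.1 i ≤ dist q p := (Real.le_norm_self _).trans
        ((PiLp.norm_apply_le (q.1 - p.1) i).trans_eq (dist_eq_norm q.1 p.1).symm)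
    _ ≤ ε⁻¹ * dist q p * p.1 i := by
        rw [inv_mul_eq_div, div_mul_eq_mul_div, le_div_iff₀ hε]
        exact mul_le_mul_of_nonneg_left (hp i) dist_nonneg

lemma eq_of_inner_weightRatio_sub_le
    (h : ⟪weightRatio w p, w - w'⟫_ℝ ≤ ⟪weightRatio w' p, w - w'⟫_ℝ) : w = w' := by
  have hsum : ∑ i, (w i - w' i) ^ 2 / p.1 i ≤ 0 := by
    rw [inner_weightRatio, inner_weightRatio, ← sub_nonpos, ← Finset.sum_sub_distrib] at h
    refine (Finset.sum_congr rfl fun i _ => ?_).trans_le h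
    simp only [PiLp.sub_apply]
    ring
  have hnonneg : ∀ i ∈ Finset.univ, 0 ≤ (w i - w' i) ^ 2 / p.1 i :=
    fun i _ => div_nonneg (sq_nonneg _) (p.2.1 i).le
  ext i
  have hi := (Finset.sum_eq_zero_iff_of_nonneg hnonneg).1
    (hsum.antisymm (Finset.sum_nonneg hnonneg)) i (Finset.mem_univ i)
  rw [div_eq_zero_iff, or_iff_left (p.2.1 i).ne', sq_eq_zero_iff] at hi
  exact sub_eq_zero.1 hi

lemma one_add_weightRatioInner {π : openSimplex n → EuclideanSpace ℝ (Fin n)}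
    (h : π p ∈ closedSimplex n) (q : openSimplex n) :
    1 + weightRatioInner π p q = ⟪weightRatio (π p) p, (q : _)⟫_ℝ := by
  rw [← inner_weightRatio_self h (p := p), ← eq_sub_iff_add_eq', ← inner_sub_right,
    inner_weightRatio]
  exact Finset.sum_congr rfl fun i _ => mul_comm_div _ _ _

/-! ### Generators -/

/-- The weights that a portfolio generated by `exp φ` may take at `p`: a multiplicative analogue of
the superdifferential of `φ` at `p`. -/
def generators (φ : openSimplex n → ℝ) (p : openSimplex n) : Set (EuclideanSpace ℝ (Fin n)) :=
  {w ∈ closedSimplex n | ∀ q : openSimplex n,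
    Real.exp (φ q - φ p) ≤ ⟪weightRatio w p, (q : _)⟫_ℝ}

variable {φ φ' : openSimplex n → ℝ} {π : openSimplex n → EuclideanSpace ℝ (Fin n)}

lemma sub_le_of_mem_generators (hw : w ∈ generators φ p) (hε : 0 < ε)
    (hp : p ∈ truncatedSimplex n ε) (q : openSimplex n) : φ q - φ p ≤ ε⁻¹ * dist q p :=
  calc φ q - φ p ≤ Real.exp (φ q - φ p) - 1 := le_sub_iff_add_le.2 (Real.add_one_le_exp _)
    _ ≤ ⟪weightRatio w p, (q : _)⟫_ℝ - 1 := sub_le_sub_right (hw.2 q) 1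
    _ ≤ ε⁻¹ * dist q p := inner_weightRatio_sub_one_le hw.1 hε hp

lemma lipschitzOnWith_truncatedSimplex (h : ∀ p, (generators φ p).Nonempty) (hε : 0 < ε) :
    LipschitzOnWith (Real.toNNReal ε⁻¹) φ (truncatedSimplex n ε) := by
  refine LipschitzOnWith.of_le_add_mul' _ fun q _ p hp => ?_
  obtain ⟨w, hw⟩ := h p
  exact sub_le_iff_le_add'.1 (sub_le_of_mem_generators hw hε hp q)

lemma locallyLipschitz_of_generators_nonempty (h : ∀ p, (generators φ p).Nonempty) :
    LocallyLipschitz φ := fun p => by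
  obtain ⟨ε, hε, hp⟩ := exists_truncatedSimplex_mem_nhds p
  exact ⟨_, _, hp, lipschitzOnWith_truncatedSimplex h hε⟩

lemma equicontinuous_of_generators_nonempty {ι : Type*} {φ : ι → openSimplex n → ℝ}
    (h : ∀ k p, (generators (φ k) p).Nonempty) : Equicontinuous φ := fun p => by
  obtain ⟨ε, hε, hp⟩ := exists_truncatedSimplex_mem_nhds p
  have hwithin := (LipschitzOnWith.uniformEquicontinuousOn φ _ fun k =>
    lipschitzOnWith_truncatedSimplex (h k) hε).equicontinuousOn p (mem_of_mem_nhds hp)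
  rwa [EquicontinuousWithinAt, nhdsWithin_eq_nhds.2 hp] at hwithin

lemma exists_subseq_tendsto_of_generators_nonempty {φ : ℕ → openSimplex n → ℝ}
    (h : ∀ k p, (generators (φ k) p).Nonempty) {p₀ : openSimplex n} (h₀ : ∀ k, φ k p₀ = 0) :
    ∃ s : ℕ → ℕ, StrictMono s ∧ ∃ φ' : openSimplex n → ℝ,
      ∀ p, Tendsto (fun k => φ (s k) p) atTop (𝓝 (φ' p)) := by
  refine exists_subseq_tendsto_of_equicontinuous (equicontinuous_of_generators_nonempty h)
    fun p => ?_
  obtain ⟨ε, hε, hpp₀⟩ := exists_subset_truncatedSimplex (Set.toFinite {p, p₀}).isCompact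
  refine Metric.isBounded_closedBall.subset
    (t := Metric.closedBall (0 : ℝ) (ε⁻¹.toNNReal * dist p p₀)) ?_
  rintro _ ⟨k, rfl⟩
  rw [Metric.mem_closedBall, ← h₀ k]
  exact (lipschitzOnWith_truncatedSimplex (h k) hε).dist_le_mul p (hpp₀ (by simp)) p₀
    (hpp₀ (by simp))

lemma mem_generators_of_tendsto {ι : Type*} {l : Filter ι} [l.NeBot] {φ : ι → openSimplex n → ℝ}
    {x : ι → openSimplex n} {w : ι → EuclideanSpace ℝ (Fin n)}
    (hφ : ∀ q, Tendsto (fun j => φ j q) l (𝓝 (φ' q)))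
    (hφx : Tendsto (fun j => φ j (x j)) l (𝓝 (φ' p))) (hx : Tendsto x l (𝓝 p))
    (hw : Tendsto w l (𝓝 w')) (h : ∀ j, w j ∈ generators (φ j) (x j)) : w' ∈ generators φ' p := by
  refine ⟨isCompact_closedSimplex.isClosed.mem_of_tendsto hw
    (Eventually.of_forall fun j => (h j).1), fun q => ?_⟩
  refine le_of_tendsto_of_tendsto' (((hφ q).sub hφx).rexp) ?_ fun j => (h j).2 q
  exact ((continuousAt_weightRatio w' p).tendsto.comp (hw.prodMk_nhds hx)).inner tendsto_const_nhds

lemma generators_nonempty_of_tendsto {φ : ℕ → openSimplex n → ℝ}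
    (hφ : ∀ q, Tendsto (fun k => φ k q) atTop (𝓝 (φ' q)))
    (h : ∀ k p, (generators (φ k) p).Nonempty) (p : openSimplex n) :
    (generators φ' p).Nonempty := by
  choose w hw using fun k => h k p
  obtain ⟨w', -, s, hs, hw'⟩ := isCompact_closedSimplex.tendsto_subseq fun k => (hw k).1
  have hφs := fun q => (hφ q).comp hs.tendsto_atTop
  exact ⟨w', mem_generators_of_tendsto hφs (hφs p) tendsto_const_nhds hw' fun k => hw (s k)⟩

lemma exists_tendsto_of_generators_subsingleton {φ : ℕ → openSimplex n → ℝ}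
    {π : ℕ → openSimplex n → EuclideanSpace ℝ (Fin n)}
    (hφ : ∀ q, Tendsto (fun k => φ k q) atTop (𝓝 (φ' q))) (hπ : ∀ k p, π k p ∈ generators (φ k) p)
    (hp : (generators φ' p).Subsingleton) :
    ∃ w ∈ generators φ' p, Tendsto (Function.uncurry π) (atTop ×ˢ 𝓝 p) (𝓝 w) := by
  have hne : ∀ k p, (generators (φ k) p).Nonempty := fun k p => ⟨_, hπ k p⟩
  obtain ⟨w, hw⟩ := generators_nonempty_of_tendsto hφ hne p
  refine ⟨w, hw, isCompact_closedSimplex.tendsto_nhds_of_unique_mapClusterPt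
    (Eventually.of_forall fun z => (hπ z.1 z.2).1) fun w' _ hw' => hp ?_ hw⟩
  obtain ⟨U, hU, hUw'⟩ := mapClusterPt_iff_ultrafilter.1 hw'
  have hφp := tendsto_uncurry_of_equicontinuousAt (equicontinuous_of_generators_nonempty hne p)
    (hφ p)
  exact mem_generators_of_tendsto (fun q => ((hφ q).comp tendsto_fst).mono_left hU)
    (hφp.mono_left hU) (tendsto_snd.mono_left hU) hUw' fun z => hπ z.1 z.2

lemma exists_subseq_tendsto_of_mem_generators {φ : ℕ → openSimplex n → ℝ}
    {π : ℕ → openSimplex n → EuclideanSpace ℝ (Fin n)} (hπ : ∀ k p, π k p ∈ generators (φ k) p)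
    {p₀ : openSimplex n} (h₀ : ∀ k, φ k p₀ = 0) (p : openSimplex n) :
    ∃ s : ℕ → ℕ, StrictMono s ∧ ∃ φ' : openSimplex n → ℝ,
      (∀ q, Tendsto (fun k => φ (s k) q) atTop (𝓝 (φ' q))) ∧
        ∃ w ∈ generators φ' p, Tendsto (fun k => π (s k) p) atTop (𝓝 w) := by
  obtain ⟨s, hs, φ', hφs⟩ := exists_subseq_tendsto_of_generators_nonempty
    (fun k q => ⟨_, hπ k q⟩) h₀
  obtain ⟨w, -, r, hr, hw⟩ := isCompact_closedSimplex.tendsto_subseq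
    (x := fun k => π (s k) p) fun k => (hπ _ p).1
  have hφr : ∀ q, Tendsto (fun k => φ (s (r k)) q) atTop (𝓝 (φ' q)) :=
    fun q => (hφs q).comp hr.tendsto_atTop
  exact ⟨s ∘ r, hs.comp hr, φ', hφr, w,
    mem_generators_of_tendsto hφr (hφr p) tendsto_const_nhds hw fun k => hπ _ p, hw⟩

/-! ### The chart of the simplex -/

/-- The tangent space of the simplex, as a subspace of the ambient Euclidean space. -/
noncomputable def simplexTangent (n : ℕ) : Submodule ℝ (EuclideanSpace ℝ (Fin n)) :=
  (ℝ ∙ WithLp.toLp 2 (1 : Fin n → ℝ))ᗮ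

lemma mem_simplexTangent : u ∈ simplexTangent n ↔ ∑ i, u i = 0 := by
  simp [simplexTangent, Submodule.mem_orthogonal_singleton_iff_inner_right, PiLp.inner_apply]

lemma finrank_simplexTangent (hn : n ≠ 0) : Module.finrank ℝ (simplexTangent n) = n - 1 := by
  obtain ⟨m, rfl⟩ := Nat.exists_eq_succ_of_ne_zero hn
  have : Fact (Module.finrank ℝ (EuclideanSpace ℝ (Fin (m + 1))) = m + 1) :=
    ⟨finrank_euclideanSpace_fin⟩
  refine Submodule.finrank_orthogonal_span_singleton (n := m) fun h => ?_
  simpa using congrArg (fun v : EuclideanSpace ℝ (Fin (m + 1)) => v 0) h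

/-- The isometric chart `p ↦ p - p₀` of the simplex with values in its tangent space. -/
noncomputable def simplexChart (p₀ p : openSimplex n) : simplexTangent n :=
  ⟨p.1 - p₀.1, mem_simplexTangent.2 (by simp [p.2.2, p₀.2.2])⟩

lemma isometry_simplexChart (p₀ : openSimplex n) : Isometry (simplexChart p₀) :=
  Isometry.of_dist_eq fun p q => dist_sub_right p.1 q.1 p₀.1

lemma range_simplexChart (p₀ : openSimplex n) :
    Set.range (simplexChart p₀) = {x | ∀ i, 0 < x.1 i + p₀.1 i} := by
  refine Set.Subset.antisymm ?_ fun x hx => ?_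
  · rintro _ ⟨p, rfl⟩ i
    simpa [simplexChart] using p.2.1 i
  · have hsum : ∑ i, (x.1 + p₀.1) i = 1 := by
      simp [Finset.sum_add_distrib, mem_simplexTangent.1 x.2, p₀.2.2]
    exact ⟨⟨x.1 + p₀.1, hx, hsum⟩, Subtype.ext (add_sub_cancel_right _ _)⟩

lemma isOpenEmbedding_simplexChart (p₀ : openSimplex n) : IsOpenEmbedding (simplexChart p₀) := by
  refine ⟨(isometry_simplexChart p₀).isEmbedding, ?_⟩
  rw [range_simplexChart, Set.ofPred_forall]
  exact isOpen_iInter_of_finite fun i => isOpen_lt continuous_const (by fun_prop)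

lemma surfaceMeasure_apply (p₀ : openSimplex n) (s : Set (openSimplex n)) :
    surfaceMeasure n s = volume (simplexChart p₀ '' s) := by
  have hn : n ≠ 0 := by
    rintro rfl
    simpa using p₀.2.2
  rw [surfaceMeasure, ← (isometry_simplexChart p₀).euclideanHausdorffMeasure_image,
    ← InnerProductSpace.euclideanHausdorffMeasure_eq_volume, finrank_simplexTangent hn]

lemma ae_surfaceMeasure_of_ae_simplexChart (p₀ : openSimplex n) {Q : simplexTangent n → Prop}
    (h : ∀ᵐ x, Q x) : ∀ᵐ p ∂surfaceMeasure n, Q (simplexChart p₀ p) := by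
  rw [ae_iff, surfaceMeasure_apply p₀]
  exact measure_mono_null (Set.image_subset_iff.2 subset_rfl) h

/-- The function `φ` on the simplex read in the chart `simplexChart p₀`, with value `0` outside the
range of the chart. -/
noncomputable def chartExtension (p₀ : openSimplex n) (φ : openSimplex n → ℝ) :
    simplexTangent n → ℝ :=
  Function.extend (simplexChart p₀) φ 0

lemma chartExtension_simplexChart (p₀ : openSimplex n) (φ : openSimplex n → ℝ)
    (p : openSimplex n) : chartExtension p₀ φ (simplexChart p₀ p) = φ p :=
  (isometry_simplexChart p₀).injective.extend_apply _ _ _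

lemma locallyLipschitzOn_chartExtension (p₀ : openSimplex n) (hφ : LocallyLipschitz φ) :
    LocallyLipschitzOn (Set.range (simplexChart p₀)) (chartExtension p₀ φ) := by
  rintro _ ⟨p, rfl⟩
  obtain ⟨C, t, ht, hC⟩ := hφ p
  refine ⟨C, _, mem_nhdsWithin_of_mem_nhds
    ((isOpenEmbedding_simplexChart p₀).image_mem_nhds.2 ht), ?_⟩
  rintro _ ⟨x, hx, rfl⟩ _ ⟨y, hy, rfl⟩
  simpa only [chartExtension_simplexChart, (isometry_simplexChart p₀).edist_eq] using hC hx hy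

lemma fderiv_chartExtension_of_mem_generators {p₀ : openSimplex n} (hw : w ∈ generators φ p)
    (hd : DifferentiableAt ℝ (chartExtension p₀ φ) (simplexChart p₀ p)) (v : simplexTangent n) :
    fderiv ℝ (chartExtension p₀ φ) (simplexChart p₀ p) v = ⟪weightRatio w p, (v : _)⟫_ℝ := by
  let excess : simplexTangent n → ℝ := fun x =>
    Real.exp (chartExtension p₀ φ x - φ p) - ⟪weightRatio w p, p₀.1 + x⟫_ℝ
  have excess_simplexChart : ∀ q, excess (simplexChart p₀ q) =
      Real.exp (φ q - φ p) - ⟪weightRatio w p, (q : _)⟫_ℝ := fun q => by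
    simp only [excess, chartExtension_simplexChart]
    rw [simplexChart, add_sub_cancel]
  have hmax : IsLocalMax excess (simplexChart p₀ p) := by
    filter_upwards [(isOpenEmbedding_simplexChart p₀).isOpen_range.mem_nhds ⟨p, rfl⟩]
    rintro _ ⟨q, rfl⟩
    rw [excess_simplexChart, excess_simplexChart, sub_self (φ p), Real.exp_zero,
      inner_weightRatio_self hw.1, sub_self]
    exact sub_nonpos.2 (hw.2 q)
  have hderiv : HasFDerivAt excess (fderiv ℝ (chartExtension p₀ φ) (simplexChart p₀ p) -
      (innerSL ℝ (weightRatio w p)).comp (simplexTangent n).subtypeL) (simplexChart p₀ p) := by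
    have hexp := (hd.hasFDerivAt.sub_const (φ p)).exp
    rw [chartExtension_simplexChart, sub_self, Real.exp_zero, one_smul] at hexp
    exact hexp.sub ((innerSL ℝ (weightRatio w p)).hasFDerivAt.comp _
      ((simplexTangent n).subtypeL.hasFDerivAt.const_add p₀.1))
  exact sub_eq_zero.1 (DFunLike.congr_fun (hmax.hasFDerivAt_eq_zero hderiv) v)

lemma generators_subsingleton_of_differentiableAt {p₀ : openSimplex n}
    (hd : DifferentiableAt ℝ (chartExtension p₀ φ) (simplexChart p₀ p)) :
    (generators φ p).Subsingleton := fun w hw w' hw' => by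
  have hv : w - w' ∈ simplexTangent n :=
    mem_simplexTangent.2 (by simp [Finset.sum_sub_distrib, hw.1.2, hw'.1.2])
  exact eq_of_inner_weightRatio_sub_le
    ((fderiv_chartExtension_of_mem_generators hw hd ⟨_, hv⟩).ge.trans
      (fderiv_chartExtension_of_mem_generators hw' hd ⟨_, hv⟩).le)

lemma ae_generators_subsingleton (hφ : ∀ p, (generators φ p).Nonempty) :
    ∀ᵐ p ∂surfaceMeasure n, (generators φ p).Subsingleton := by
  rcases isEmpty_or_nonempty (openSimplex n) with _ | ⟨⟨p₀⟩⟩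
  · exact Eventually.of_forall fun p => isEmptyElim p
  have hdiff := ae_differentiableAt_of_locallyLipschitzOn volume
    (isOpenEmbedding_simplexChart p₀).isOpen_range
    (locallyLipschitzOn_chartExtension p₀ (locallyLipschitz_of_generators_nonempty hφ))
  filter_upwards [ae_surfaceMeasure_of_ae_simplexChart p₀ hdiff] with p hp
  exact generators_subsingleton_of_differentiableAt (hp ⟨p, rfl⟩)

lemma ae_mem_posTangentConeAt_image_val {S : Set (openSimplex n)} (hS : MeasurableSet S) :
    ∀ᵐ p ∂surfaceMeasure n, p ∈ S → ∀ S' : Set (openSimplex n), surfaceMeasure n (S \ S') = 0 →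
      ∀ v : EuclideanSpace ℝ (Fin n), ∑ i, v i = 0 →
        v ∈ posTangentConeAt (Subtype.val '' S') p.1 := by
  rcases isEmpty_or_nonempty (openSimplex n) with _ | ⟨⟨p₀⟩⟩
  · exact Eventually.of_forall fun p => isEmptyElim p
  have hS₀ := (isOpenEmbedding_simplexChart p₀).measurableEmbedding.measurableSet_image.2 hS
  have hdensity := (ae_restrict_iff' hS₀).1
    (ae_restrict_posTangentConeAt_eq_univ volume (simplexChart p₀ '' S))
  filter_upwards [ae_surfaceMeasure_of_ae_simplexChart p₀ hdensity] with p hp hpS S' hS' v hv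
  rw [surfaceMeasure_apply p₀, Set.image_sdiff (isometry_simplexChart p₀).injective] at hS'
  have hcone : (⟨v, mem_simplexTangent.2 hv⟩ : simplexTangent n) ∈
      posTangentConeAt (simplexChart p₀ '' S') (simplexChart p₀ p) :=
    (hp ⟨p, hpS, rfl⟩ _ hS').symm ▸ Set.mem_univ _
  obtain ⟨c, d, hd, hmem, hcd⟩ := mem_tangentConeAt_iff_exists_seq.1 hcone
  refine mem_tangentConeAt_of_seq atTop c (fun k => (d k : EuclideanSpace ℝ (Fin n)))
    ((continuous_subtype_val.tendsto 0).comp hd) ?_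
    ((continuous_subtype_val.tendsto _).comp hcd)
  filter_upwards [hmem] with k ⟨q, hq, hqk⟩
  refine ⟨q, hq, ?_⟩
  have hval : q.1 - p₀.1 = p.1 - p₀.1 + d k := congrArg Subtype.val hqk
  rw [← sub_left_inj (a := p₀.1), hval, add_sub_right_comm]

/-! ### Functionally generated portfolios -/

variable {π' : openSimplex n → EuclideanSpace ℝ (Fin n)} {Φ Φ' : EuclideanSpace ℝ (Fin n) → ℝ}
  {a b : ℝ}

lemma concaveOn_openSimplex_of_generates (hπ : ∀ p, π p ∈ closedSimplex n)
    (hpos : ∀ p ∈ openSimplex n, 0 < Φ p)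
    (hgen : ∀ p q : openSimplex n, Φ q / Φ p ≤ 1 + weightRatioInner π p q) :
    ConcaveOn ℝ (openSimplex n) Φ := by
  refine concaveOn_of_forall_exists_le_add convex_openSimplex fun z hz =>
    ⟨Φ z • (innerSL ℝ (weightRatio (π ⟨z, hz⟩) z)).toLinearMap, fun y hy => ?_⟩
  have hyz := (div_le_iff₀ (hpos z hz)).1 (hgen ⟨z, hz⟩ ⟨y, hy⟩)
  have hself := inner_weightRatio_self (hπ ⟨z, hz⟩) (p := ⟨z, hz⟩)
  rw [one_add_weightRatioInner (hπ _)] at hyz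
  simp only [LinearMap.smul_apply, ContinuousLinearMap.coe_coe, innerSL_apply_apply,
    inner_sub_right, smul_eq_mul]
  linear_combination hyz + Φ z * hself

lemma IsFunctionallyGenerated.convexComb (h : IsFunctionallyGenerated π Φ)
    (h' : IsFunctionallyGenerated π' Φ') (ha : 0 ≤ a) (hb : 0 ≤ b) (hab : a + b = 1) :
    IsFunctionallyGenerated (a • π + b • π') (fun x => Φ x ^ a * Φ' x ^ b) := by
  have hmem : ∀ p, (a • π + b • π') p ∈ closedSimplex n := fun p =>
    convex_closedSimplex (h.isPortfolio.2 p) (h'.isPortfolio.2 p) ha hb hab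
  have hpos : ∀ x ∈ openSimplex n, 0 < Φ x ^ a * Φ' x ^ b := fun x hx =>
    mul_pos (Real.rpow_pos_of_pos (h.pos x hx) a) (Real.rpow_pos_of_pos (h'.pos x hx) b)
  have hgen : ∀ p q : openSimplex n, Φ q ^ a * Φ' q ^ b / (Φ p ^ a * Φ' p ^ b) ≤
      1 + weightRatioInner (a • π + b • π') p q := fun p q => by
    have hΦ := div_nonneg (h.pos q q.2).le (h.pos p p.2).le
    have hΦ' := div_nonneg (h'.pos q q.2).le (h'.pos p p.2).le
    calc Φ q ^ a * Φ' q ^ b / (Φ p ^ a * Φ' p ^ b)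
        = (Φ q / Φ p) ^ a * (Φ' q / Φ' p) ^ b := by
          rw [Real.div_rpow (h.pos q q.2).le (h.pos p p.2).le,
            Real.div_rpow (h'.pos q q.2).le (h'.pos p p.2).le, mul_div_mul_comm]
      _ ≤ a * (Φ q / Φ p) + b * (Φ' q / Φ' p) :=
          Real.geom_mean_le_arith_mean2_weighted ha hb hΦ hΦ' hab
      _ ≤ a * (1 + weightRatioInner π p q) + b * (1 + weightRatioInner π' p q) := by
          gcongr
          exacts [h.generates p q, h'.generates p q]
      _ = 1 + weightRatioInner (a • π + b • π') p q := by
          rw [one_add_weightRatioInner (h.isPortfolio.2 p),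
            one_add_weightRatioInner (h'.isPortfolio.2 p), one_add_weightRatioInner (hmem p),
            Pi.add_apply, Pi.smul_apply, Pi.smul_apply, weightRatio_convexComb,
            inner_add_left, real_inner_smul_left, real_inner_smul_left]
  exact ⟨⟨(h.isPortfolio.1.const_smul a).add (h'.isPortfolio.1.const_smul b), hmem⟩, hpos,
    concaveOn_openSimplex_of_generates hmem hpos hgen, hgen⟩

/-- The logarithm of `Φ` on the simplex, normalized to vanish at `p₀`. Generating functions matter
only up to a positive factor, and the normalization makes their logarithms relatively compact. -/
noncomputable def normalizedLog (p₀ : openSimplex n) (Φ : EuclideanSpace ℝ (Fin n) → ℝ)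
    (p : openSimplex n) : ℝ :=
  Real.log (Φ p) - Real.log (Φ p₀)

lemma IsFunctionallyGenerated.mem_generators (h : IsFunctionallyGenerated π Φ)
    (p₀ p : openSimplex n) : π p ∈ generators (normalizedLog p₀ Φ) p := by
  refine ⟨h.isPortfolio.2 p, fun q => ?_⟩
  rw [normalizedLog, normalizedLog, sub_sub_sub_cancel_right, Real.exp_sub,
    Real.exp_log (h.pos q q.2), Real.exp_log (h.pos p p.2),
    ← one_add_weightRatioInner (h.isPortfolio.2 p)]
  exact h.generates p q

lemma normalizedLog_convexComb (h : ∀ p ∈ openSimplex n, 0 < Φ p)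
    (h' : ∀ p ∈ openSimplex n, 0 < Φ' p) (a b : ℝ) (p₀ : openSimplex n) :
    normalizedLog p₀ (fun x => Φ x ^ a * Φ' x ^ b) =
      a • normalizedLog p₀ Φ + b • normalizedLog p₀ Φ' := by
  have log_mul_rpow : ∀ p : openSimplex n, Real.log (Φ p ^ a * Φ' p ^ b) =
      a * Real.log (Φ p) + b * Real.log (Φ' p) := fun p => by
    rw [Real.log_mul (Real.rpow_pos_of_pos (h p p.2) a).ne'
      (Real.rpow_pos_of_pos (h' p p.2) b).ne', Real.log_rpow (h p p.2), Real.log_rpow (h' p p.2)]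
  funext p
  simp only [normalizedLog, log_mul_rpow, Pi.add_apply, Pi.smul_apply, smul_eq_mul]
  ring

/-- The L-divergence from `z.1` to `z.2` of a portfolio `π` with generating function `exp φ`. -/
noncomputable def logGap (φ : openSimplex n → ℝ) (π : openSimplex n → EuclideanSpace ℝ (Fin n))
    (z : openSimplex n × openSimplex n) : ℝ :=
  Real.log ⟪weightRatio (π z.1) z.1, (z.2 : _)⟫_ℝ - (φ z.2 - φ z.1)

lemma IsFunctionallyGenerated.LDivergence_eq_logGap (h : IsFunctionallyGenerated π Φ)
    (p₀ q p : openSimplex n) :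
    LDivergence π Φ q p = logGap (normalizedLog p₀ Φ) π (p, q) := by
  rw [LDivergence, logGap, one_add_weightRatioInner (h.isPortfolio.2 p), normalizedLog,
    normalizedLog, sub_sub_sub_cancel_right, Real.log_div (h.pos q q.2).ne' (h.pos p p.2).ne']

lemma IsOptimalPortfolio.integral_logGap_le {P : Measure (openSimplex n × openSimplex n)}
    (h : IsOptimalPortfolio P π Φ) (h' : IsFunctionallyGenerated π' Φ') (p₀ : openSimplex n) :
    ∫ z, logGap (normalizedLog p₀ Φ') π' z ∂P ≤ ∫ z, logGap (normalizedLog p₀ Φ) π z ∂P := by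
  simpa only [h.1.LDivergence_eq_logGap p₀, h'.LDivergence_eq_logGap p₀] using h.2 π' Φ' h'

lemma abs_logGap_le (hπ : ∀ p, π p ∈ generators φ p) (hε : 0 < ε) (hp : p ∈ truncatedSimplex n ε)
    (hq : q ∈ truncatedSimplex n ε) : |logGap φ π (p, q)| ≤ 2 * Real.log ε⁻¹ := by
  have hlow : φ q - φ p ≤ Real.log ⟪weightRatio (π p) p, (q : _)⟫_ℝ :=
    (Real.le_log_iff_exp_le (inner_weightRatio_pos (hπ p).1)).2 ((hπ p).2 q)
  have hupp : Real.log ⟪weightRatio (π p) p, (q : _)⟫_ℝ ≤ Real.log ε⁻¹ :=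
    Real.log_le_log (inner_weightRatio_pos (hπ p).1) (inner_weightRatio_le_inv (hπ p).1 hε hp)
  have hpq : φ p - φ q ≤ Real.log ε⁻¹ :=
    (Real.le_log_iff_exp_le (inv_pos.2 hε)).2
      (((hπ q).2 p).trans (inner_weightRatio_le_inv (hπ q).1 hε hq))
  rw [logGap, abs_of_nonneg (sub_nonneg.2 hlow)]
  linarith

lemma measurable_logGap (hφ : Continuous φ) (hπ : Measurable π) : Measurable (logGap φ π) := by
  have hinner : Measurable fun z : openSimplex n × openSimplex n =>
      ⟪weightRatio (π z.1) z.1, (z.2 : _)⟫_ℝ := by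
    simp only [inner_weightRatio]
    fun_prop
  exact hinner.log.sub ((hφ.measurable.comp measurable_snd).sub (hφ.measurable.comp measurable_fst))

lemma tendsto_logGap {φ : ℕ → openSimplex n → ℝ} {π : ℕ → openSimplex n → EuclideanSpace ℝ (Fin n)}
    (hφ : ∀ q, Tendsto (fun k => φ k q) atTop (𝓝 (φ' q))) (hπ : ∀ k p, π k p ∈ generators (φ k) p)
    (hlim : Tendsto (Function.uncurry π) (atTop ×ˢ 𝓝 p) (𝓝 (π' p))) (q : openSimplex n) :
    Tendsto (Function.uncurry fun k => logGap (φ k) (π k)) (atTop ×ˢ 𝓝 (p, q))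
      (𝓝 (logGap φ' π' (p, q))) := by
  have hmem : π' p ∈ closedSimplex n := isCompact_closedSimplex.isClosed.mem_of_tendsto hlim
    (Eventually.of_forall fun x => (hπ x.1 x.2).1)
  have hfst : Tendsto (fun z : ℕ × openSimplex n × openSimplex n => (z.1, z.2.1))
      (atTop ×ˢ 𝓝 (p, q)) (atTop ×ˢ 𝓝 p) :=
    tendsto_fst.prodMk ((continuous_fst.tendsto (p, q)).comp tendsto_snd)
  have hsnd : Tendsto (fun z : ℕ × openSimplex n × openSimplex n => (z.1, z.2.2))
      (atTop ×ˢ 𝓝 (p, q)) (atTop ×ˢ 𝓝 q) :=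
    tendsto_fst.prodMk ((continuous_snd.tendsto (p, q)).comp tendsto_snd)
  have hφc := fun x => tendsto_uncurry_of_equicontinuousAt
    (equicontinuous_of_generators_nonempty (fun k p => ⟨_, hπ k p⟩) x) (hφ x)
  have hinner := ((continuousAt_weightRatio (π' p) p).tendsto.comp
    ((hlim.comp hfst).prodMk_nhds (tendsto_snd.comp hfst))).inner (𝕜 := ℝ)
      ((continuous_subtype_val.tendsto q).comp (tendsto_snd.comp hsnd))
  exact (hinner.log (inner_weightRatio_pos hmem).ne').sub
    (((hφc q).comp hsnd).sub ((hφc p).comp hfst))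

lemma logGap_convexComb_le (hp : π p ∈ closedSimplex n) (hp' : π' p ∈ closedSimplex n)
    (ha : 0 ≤ a) (hb : 0 ≤ b) (hab : a + b = 1) :
    a * logGap φ π (p, q) + b * logGap φ' π' (p, q) ≤
      logGap (a • φ + b • φ') (a • π + b • π') (p, q) := by
  have hlog := strictConcaveOn_log_Ioi.concaveOn.2 (inner_weightRatio_pos hp (p := p) (q := q))
    (inner_weightRatio_pos hp' (p := p) (q := q)) ha hb hab
  simp only [smul_eq_mul] at hlog
  simp only [logGap, weightRatio_convexComb, inner_add_left, real_inner_smul_left, Pi.add_apply,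
    Pi.smul_apply, smul_eq_mul]
  linarith

lemma inner_weightRatio_eq_of_logGap_convexComb_eq (hp : π p ∈ closedSimplex n)
    (hp' : π' p ∈ closedSimplex n) (ha : 0 < a) (hb : 0 < b) (hab : a + b = 1)
    (h : a * logGap φ π (p, q) + b * logGap φ' π' (p, q) =
      logGap (a • φ + b • φ') (a • π + b • π') (p, q)) :
    ⟪weightRatio (π p) p, (q : _)⟫_ℝ = ⟪weightRatio (π' p) p, (q : _)⟫_ℝ := by
  by_contra hne
  have hlog := strictConcaveOn_log_Ioi.2 (inner_weightRatio_pos hp (p := p) (q := q))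
    (inner_weightRatio_pos hp' (p := p) (q := q)) hne ha hb hab
  simp only [smul_eq_mul] at hlog
  simp only [logGap, weightRatio_convexComb, inner_add_left, real_inner_smul_left, Pi.add_apply,
    Pi.smul_apply, smul_eq_mul] at h
  linarith

lemma ae_inner_weightRatio_eq_of_integral_logGap_convexComb_le
    {μ : Measure (openSimplex n × openSimplex n)} (hπ : ∀ᵐ z ∂μ, π z.1 ∈ closedSimplex n)
    (hπ' : ∀ᵐ z ∂μ, π' z.1 ∈ closedSimplex n) (ha : 0 < a) (hb : 0 < b) (hab : a + b = 1)
    (hgap : Integrable (logGap φ π) μ) (hgap' : Integrable (logGap φ' π') μ)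
    (hcomb : Integrable (logGap (a • φ + b • φ') (a • π + b • π')) μ)
    (h : ∫ z, logGap (a • φ + b • φ') (a • π + b • π') z ∂μ ≤
      a * ∫ z, logGap φ π z ∂μ + b * ∫ z, logGap φ' π' z ∂μ) :
    ∀ᵐ z ∂μ, ⟪weightRatio (π z.1) z.1, (z.2 : _)⟫_ℝ =
      ⟪weightRatio (π' z.1) z.1, (z.2 : _)⟫_ℝ := by
  have hle : ∀ᵐ z ∂μ, a * logGap φ π z + b * logGap φ' π' z ≤
      logGap (a • φ + b • φ') (a • π + b • π') z := by
    filter_upwards [hπ, hπ'] with z hz hz' using logGap_convexComb_le hz hz' ha.le hb.le hab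
  have hsum : Integrable (fun z => a * logGap φ π z + b * logGap φ' π' z) μ :=
    (hgap.const_mul a).add (hgap'.const_mul b)
  have hinteq : ∫ z, a * logGap φ π z + b * logGap φ' π' z ∂μ =
      ∫ z, logGap (a • φ + b • φ') (a • π + b • π') z ∂μ := by
    refine le_antisymm (integral_mono_ae hsum hcomb hle) (h.trans_eq ?_)
    rw [← integral_const_mul, ← integral_const_mul,
      ← integral_add (hgap.const_mul a) (hgap'.const_mul b)]
  filter_upwards [hπ, hπ', (integral_eq_iff_of_ae_le hsum hcomb hle).1 hinteq] with z hz hz' heq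
  exact inner_weightRatio_eq_of_logGap_convexComb_eq hz hz' ha hb hab heq

/-! ### Limits of optimal portfolios -/

variable {K : Set (openSimplex n)} {P : ProbabilityMeasure (openSimplex n × openSimplex n)}
  {PN : ℕ → ProbabilityMeasure (openSimplex n × openSimplex n)}
  {πN : ℕ → openSimplex n → EuclideanSpace ℝ (Fin n)} {ΦN : ℕ → EuclideanSpace ℝ (Fin n) → ℝ}

lemma continuousAt_of_generators_subsingleton (hπ : ∀ p, π p ∈ generators φ p)
    (hp : (generators φ p).Subsingleton) : ContinuousAt π p := by
  obtain ⟨w, hw, hlim⟩ := exists_tendsto_of_generators_subsingleton (φ := fun _ => φ)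
    (π := fun _ => π) (fun q => tendsto_const_nhds) (fun _ => hπ) hp
  rw [hp hw (hπ p)] at hlim
  rw [ContinuousAt, ← map_snd_prod (atTop : Filter ℕ) (𝓝 p)]
  exact tendsto_map'_iff.2 hlim

lemma tendsto_integral_logGap (hK : IsCompact K)
    (hPNK : ∀ N, (PN N : Measure (openSimplex n × openSimplex n)) (K ×ˢ K)ᶜ = 0)
    (hP : Tendsto PN atTop (𝓝 P)) {φ : ℕ → openSimplex n → ℝ}
    (hφ : ∀ q, Tendsto (fun N => φ N q) atTop (𝓝 (φ' q)))
    (hπ : ∀ N p, πN N p ∈ generators (φ N) p) (hm : ∀ N, Measurable (πN N))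
    (hlim : ∀ᵐ p ∂(P : Measure (openSimplex n × openSimplex n)).fst,
      Tendsto (Function.uncurry πN) (atTop ×ˢ 𝓝 p) (𝓝 (π' p))) :
    Integrable (logGap φ' π') (P : Measure (openSimplex n × openSimplex n)) ∧
      Tendsto (fun N => ∫ z, logGap (φ N) (πN N) z ∂(PN N : Measure _)) atTop
        (𝓝 (∫ z, logGap φ' π' z ∂(P : Measure _))) := by
  obtain ⟨ε, hε, hKε⟩ := exists_subset_truncatedSimplex hK
  have hne : ∀ N p, (generators (φ N) p).Nonempty := fun N p => ⟨_, hπ N p⟩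
  refine tendsto_integral_of_tendsto_uncurry hP (C := 2 * Real.log ε⁻¹)
    (fun N => measurable_logGap (locallyLipschitz_of_generators_nonempty (hne N)).continuous (hm N))
    (fun N => ?_) ?_
  · filter_upwards [(hPNK N : ∀ᵐ z ∂(PN N : Measure _), z ∈ K ×ˢ K)] with z hz
    exact abs_logGap_le (hπ N) hε (hKε hz.1) (hKε hz.2)
  · filter_upwards [ae_of_ae_map measurable_fst.aemeasurable hlim] with z hz
    exact tendsto_logGap hφ hπ hz z.2

lemma IsOptimalPortfolio.integral_logGap_le_of_tendsto (hK : IsCompact K)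
    (hPK : (P : Measure (openSimplex n × openSimplex n)) (K ×ˢ K)ᶜ = 0)
    (hopt : IsOptimalPortfolio (P : Measure _) π Φ)
    (hgen : ∀ N, IsFunctionallyGenerated (πN N) (ΦN N)) {p₀ : openSimplex n}
    (hφ : ∀ q, Tendsto (fun N => normalizedLog p₀ (ΦN N) q) atTop (𝓝 (φ' q)))
    (hlim : ∀ᵐ p ∂(P : Measure (openSimplex n × openSimplex n)).fst,
      Tendsto (Function.uncurry πN) (atTop ×ˢ 𝓝 p) (𝓝 (π' p))) :
    Integrable (logGap φ' π') (P : Measure (openSimplex n × openSimplex n)) ∧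
      ∫ z, logGap φ' π' z ∂(P : Measure _) ≤
        ∫ z, logGap (normalizedLog p₀ Φ) π z ∂(P : Measure _) := by
  obtain ⟨hgap, htend⟩ := tendsto_integral_logGap hK (fun _ => hPK) tendsto_const_nhds hφ
    (fun N => (hgen N).mem_generators p₀) (fun N => (hgen N).isPortfolio.1) hlim
  exact ⟨hgap, le_of_tendsto' htend fun N => hopt.integral_logGap_le (hgen N) p₀⟩

/-- The geometric mean of `Φ` and `ΦN N` competes with `Φ` for `P`, and `Φ` competes with `ΦN N` for
`PN N`. In the limit this leaves no room for the strict concavity of the logarithm. -/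
lemma ae_inner_weightRatio_eq_of_tendsto_optimal (hK : IsCompact K)
    (hPNK : ∀ N, (PN N : Measure (openSimplex n × openSimplex n)) (K ×ˢ K)ᶜ = 0)
    (hP : Tendsto PN atTop (𝓝 P)) (hopt : IsOptimalPortfolio (P : Measure _) π Φ)
    (hoptN : ∀ N, IsOptimalPortfolio (PN N : Measure _) (πN N) (ΦN N)) {p₀ : openSimplex n}
    (hφ : ∀ q, Tendsto (fun N => normalizedLog p₀ (ΦN N) q) atTop (𝓝 (φ' q)))
    (hπ : ∀ᵐ p ∂(P : Measure (openSimplex n × openSimplex n)).fst, ContinuousAt π p)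
    (hlim : ∀ᵐ p ∂(P : Measure (openSimplex n × openSimplex n)).fst,
      Tendsto (Function.uncurry πN) (atTop ×ˢ 𝓝 p) (𝓝 (π' p))) :
    ∀ᵐ z ∂(P : Measure (openSimplex n × openSimplex n)),
      ⟪weightRatio (π z.1) z.1, (z.2 : _)⟫_ℝ = ⟪weightRatio (π' z.1) z.1, (z.2 : _)⟫_ℝ := by
  have hPK : ∀ᵐ z ∂(P : Measure (openSimplex n × openSimplex n)), z ∈ K ×ˢ K :=
    ae_mem_of_tendsto_of_isClosed hP (hK.isClosed.prod hK.isClosed) hPNK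
  have hhalf : (0 : ℝ) < 2⁻¹ := by norm_num
  have hadd : (2⁻¹ : ℝ) + 2⁻¹ = 1 := by norm_num
  have hmem' : ∀ᵐ z ∂(P : Measure (openSimplex n × openSimplex n)), π' z.1 ∈ closedSimplex n := by
    filter_upwards [ae_of_ae_map measurable_fst.aemeasurable hlim] with z hz
    exact isCompact_closedSimplex.isClosed.mem_of_tendsto hz
      (Eventually.of_forall fun x => (hoptN x.1).1.isPortfolio.2 x.2)
  obtain ⟨hgap, htend⟩ := tendsto_integral_logGap hK hPNK hP (πN := fun _ => π)
    (φ := fun _ => normalizedLog p₀ Φ) (fun q => tendsto_const_nhds)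
    (fun _ => hopt.1.mem_generators p₀) (fun _ => hopt.1.isPortfolio.1)
    (hπ.mono fun p hp => hp.tendsto.comp tendsto_snd)
  obtain ⟨hgap', htend'⟩ := tendsto_integral_logGap hK hPNK hP hφ
    (fun N => (hoptN N).1.mem_generators p₀) (fun N => (hoptN N).1.isPortfolio.1) hlim
  have hle := le_of_tendsto_of_tendsto' htend htend' fun N =>
    (hoptN N).integral_logGap_le hopt.1 p₀
  have hφcomb : ∀ q, Tendsto
      (fun N => normalizedLog p₀ (fun x => Φ x ^ (2⁻¹ : ℝ) * ΦN N x ^ (2⁻¹ : ℝ)) q) atTop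
      (𝓝 (((2⁻¹ : ℝ) • normalizedLog p₀ Φ + (2⁻¹ : ℝ) • φ') q)) := fun q => by
    simp only [normalizedLog_convexComb hopt.1.pos (hoptN _).1.pos]
    exact ((hφ q).const_smul (2⁻¹ : ℝ)).const_add _
  obtain ⟨hcomb, hcomb_le⟩ := hopt.integral_logGap_le_of_tendsto hK hPK
    (fun N => hopt.1.convexComb (hoptN N).1 hhalf.le hhalf.le hadd) hφcomb
    (π' := (2⁻¹ : ℝ) • π + (2⁻¹ : ℝ) • π') (by
      filter_upwards [hπ, hlim] with p hp hp'
      exact ((hp.tendsto.comp tendsto_snd).const_smul (2⁻¹ : ℝ)).add (hp'.const_smul (2⁻¹ : ℝ)))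
  refine ae_inner_weightRatio_eq_of_integral_logGap_convexComb_le
    (Eventually.of_forall fun z => hopt.1.isPortfolio.2 z.1) hmem' hhalf hhalf hadd hgap hgap'
    hcomb (hcomb_le.trans ?_)
  linarith

lemma eq_of_ae_inner_weightRatio_eq (hw : w ∈ closedSimplex n) (hw' : w' ∈ closedSimplex n)
    {ν : Measure (openSimplex n)}
    (hν : ∀ v : EuclideanSpace ℝ (Fin n), ∑ i, v i = 0 →
      ∃ l : ℝ, 0 < l ∧ ∃ q ∈ ν.support, (q : EuclideanSpace ℝ (Fin n)) = p + l • v)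
    (h : ∀ᵐ (q : openSimplex n) ∂ν,
      ⟪weightRatio w p, (q : _)⟫_ℝ = ⟪weightRatio w' p, (q : _)⟫_ℝ) : w = w' := by
  obtain ⟨l, hl, q, hq, hqv⟩ := hν (w - w') (by simp [Finset.sum_sub_distrib, hw.2, hw'.2])
  have hclosed : IsClosed
      {q : openSimplex n | ⟪weightRatio w p, (q : _)⟫_ℝ = ⟪weightRatio w' p, (q : _)⟫_ℝ} :=
    isClosed_eq (by fun_prop) (by fun_prop)
  have hqeq : ⟪weightRatio w p, (q : _)⟫_ℝ = ⟪weightRatio w' p, (q : _)⟫_ℝ :=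
    Measure.support_subset_of_isClosed hclosed h hq
  rw [hqv, inner_add_right, inner_add_right, inner_weightRatio_self hw, inner_weightRatio_self hw',
    real_inner_smul_right, real_inner_smul_right, add_right_inj] at hqeq
  exact eq_of_inner_weightRatio_sub_le (mul_left_cancel₀ hl.ne' hqeq).le

lemma ae_mem_generators_of_tendsto_optimal (hK : IsCompact K)
    (hPNK : ∀ N, (PN N : Measure (openSimplex n × openSimplex n)) (K ×ˢ K)ᶜ = 0)
    (hP : Tendsto PN atTop (𝓝 P)) {f : openSimplex n → ℝ≥0∞} (hf : Measurable f)
    (hPf : (P : Measure (openSimplex n × openSimplex n)).fst = (surfaceMeasure n).withDensity f)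
    {κ : Kernel (openSimplex n) (openSimplex n)} [IsSFiniteKernel κ]
    (hPκ : (P : Measure (openSimplex n × openSimplex n)) =
      (P : Measure (openSimplex n × openSimplex n)).fst ⊗ₘ κ)
    (hsupp : SupportCondition f κ) (hopt : IsOptimalPortfolio (P : Measure _) π Φ)
    (hoptN : ∀ N, IsOptimalPortfolio (PN N : Measure _) (πN N) (ΦN N)) {p₀ : openSimplex n}
    (hφ : ∀ q, Tendsto (fun N => normalizedLog p₀ (ΦN N) q) atTop (𝓝 (φ' q))) :
    ∀ᵐ p ∂surfaceMeasure n, 0 < f p → π p ∈ generators φ' p := by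
  have hgenN := fun N => (hoptN N).1.mem_generators p₀
  have hac : (P : Measure (openSimplex n × openSimplex n)).fst ≪ surfaceMeasure n :=
    hPf ▸ withDensity_absolutelyContinuous _ f
  have hcont : ∀ᵐ p ∂surfaceMeasure n, ContinuousAt π p :=
    (ae_generators_subsingleton fun p => ⟨_, hopt.1.mem_generators p₀ p⟩).mono fun p =>
      continuousAt_of_generators_subsingleton (hopt.1.mem_generators p₀)
  have hlim : ∀ᵐ p ∂surfaceMeasure n, ∃ w, w ∈ generators φ' p ∧
      Tendsto (Function.uncurry πN) (atTop ×ˢ 𝓝 p) (𝓝 w) :=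
    (ae_generators_subsingleton (generators_nonempty_of_tendsto hφ fun N p => ⟨_, hgenN N p⟩)).mono
      fun p => exists_tendsto_of_generators_subsingleton hφ hgenN
  choose! π' hπ' using fun p (hp : ∃ w, w ∈ generators φ' p ∧
    Tendsto (Function.uncurry πN) (atTop ×ˢ 𝓝 p) (𝓝 w)) => hp
  have heq := ae_inner_weightRatio_eq_of_tendsto_optimal hK hPNK hP hopt hoptN hφ
    (hac.ae_le hcont) (hac.ae_le (hlim.mono fun p hp => (hπ' p hp).2))
  rw [hPκ] at heq
  have heqf := Measure.ae_ae_of_ae_compProd heq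
  rw [hPf, ae_withDensity_iff hf] at heqf
  filter_upwards [heqf, hsupp, hlim] with p hp hν hgen hfp
  obtain ⟨hmem, -⟩ := hπ' p hgen
  rwa [eq_of_ae_inner_weightRatio_eq (hopt.1.isPortfolio.2 p) hmem.1 (hν hfp) (hp (ne_of_gt hfp))]

/-! ### Generators along tangent directions -/

lemma one_le_inner_weightRatio_mul (hw : w ∈ generators φ p) (hw' : w' ∈ generators φ q) :
    1 ≤ ⟪weightRatio w p, (q : _)⟫_ℝ * ⟪weightRatio w' q, (p : _)⟫_ℝ :=
  calc 1 = Real.exp (φ q - φ p) * Real.exp (φ p - φ q) := by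
        rw [← Real.exp_add, sub_add_sub_cancel, sub_self, Real.exp_zero]
    _ ≤ _ := mul_le_mul (hw.2 q) (hw'.2 p) (Real.exp_nonneg _) (inner_weightRatio_pos hw.1).le

/-- The map `generators φ` is antitone, being a superdifferential. -/
lemma inner_weightRatio_le_of_tendsto (hw : w ∈ generators φ p) {x : ℕ → openSimplex n}
    {y : ℕ → EuclideanSpace ℝ (Fin n)} {c : ℕ → ℝ≥0} {v : EuclideanSpace ℝ (Fin n)}
    (hy : ∀ᶠ k in atTop, y k ∈ generators φ (x k)) (hx : Tendsto x atTop (𝓝 p))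
    (hyw : Tendsto y atTop (𝓝 w')) (hv : Tendsto (fun k => c k • ((x k).1 - p.1)) atTop (𝓝 v)) :
    ⟪weightRatio w' p, v⟫_ℝ ≤ ⟪weightRatio w p, v⟫_ℝ := by
  have hratio := (continuousAt_weightRatio w' p).tendsto.comp (hyw.prodMk_nhds hx)
  have hdiff : Tendsto (fun k => (x k).1 - p.1) atTop (𝓝 0) :=
    sub_self p.1 ▸ ((continuous_subtype_val.tendsto p).comp hx).sub_const p.1
  have hA := (tendsto_const_nhds (x := weightRatio w p)).inner (𝕜 := ℝ) hv
  have hB := hratio.inner (𝕜 := ℝ) hv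
  have hb := hratio.inner (𝕜 := ℝ) hdiff
  rw [inner_zero_right] at hb
  have hlim := (hA.sub hB).sub (hA.mul hb)
  rw [mul_zero, sub_zero] at hlim
  refine sub_nonneg.1 (ge_of_tendsto hlim ?_)
  filter_upwards [hy] with k hk
  have hprod := one_le_inner_weightRatio_mul hw hk
  have hwself := inner_weightRatio_self hw.1 (p := p)
  have hyself := inner_weightRatio_self hk.1 (p := x k)
  simp only [Function.comp_apply, NNReal.smul_def, real_inner_smul_right, inner_sub_right, hwself,
    hyself]
  nlinarith [mul_nonneg (c k).2 (sub_nonneg.2 hprod)]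

lemma eq_of_forall_mem_posTangentConeAt (hp : π p ∈ closedSimplex n) (hcont : ContinuousAt π p)
    (hcone : ∀ v : EuclideanSpace ℝ (Fin n), ∑ i, v i = 0 →
      v ∈ posTangentConeAt (Subtype.val '' {q | π q ∈ generators φ q}) p.1)
    (hw : w ∈ generators φ p) : π p = w := by
  obtain ⟨c, d, hd, hmem, hcd⟩ := mem_tangentConeAt_iff_exists_seq.1
    (hcone (π p - w) (by simp [Finset.sum_sub_distrib, hp.2, hw.1.2]))
  obtain ⟨x, hx⟩ := hmem.choice
  have hxd : (fun k => p.1 + d k) =ᶠ[atTop] fun k => (x k).1 := hx.mono fun k hk => hk.2.symm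
  have hxp : Tendsto x atTop (𝓝 p) :=
    tendsto_subtype_rng.2 (((hd.const_add p.1).congr' hxd).trans_eq (by rw [add_zero]))
  refine eq_of_inner_weightRatio_sub_le (p := p) (inner_weightRatio_le_of_tendsto (c := c) hw
    (hx.mono fun k hk => hk.1) hxp (hcont.tendsto.comp hxp) (hcd.congr' ?_))
  filter_upwards [hxd] with k hk
  rw [← hk, add_sub_cancel_left]

end Simplex

theorem theorem5p5_general (n : ℕ)
    (K : Set (openSimplex n)) (hK : IsCompact K)
    (P : ProbabilityMeasure (openSimplex n × openSimplex n))
    (f : openSimplex n → ℝ≥0∞) (hf : Measurable f)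
    (hPf : (P : Measure (openSimplex n × openSimplex n)).fst = (surfaceMeasure n).withDensity f)
    (κ : Kernel (openSimplex n) (openSimplex n)) [IsSFiniteKernel κ]
    (hPκ : (P : Measure (openSimplex n × openSimplex n)) =
      (P : Measure (openSimplex n × openSimplex n)).fst ⊗ₘ κ)
    (hsupp : SupportCondition f κ)
    (π : openSimplex n → EuclideanSpace ℝ (Fin n)) (Φ : EuclideanSpace ℝ (Fin n) → ℝ)
    (hopt : IsOptimalPortfolio (P : Measure (openSimplex n × openSimplex n)) π Φ)
    (PN : ℕ → ProbabilityMeasure (openSimplex n × openSimplex n))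
    (hPNK : ∀ N, (PN N : Measure (openSimplex n × openSimplex n)) (K ×ˢ K)ᶜ = 0)
    (hconv : Tendsto PN atTop (𝓝 P))
    (πN : ℕ → openSimplex n → EuclideanSpace ℝ (Fin n))
    (ΦN : ℕ → EuclideanSpace ℝ (Fin n) → ℝ)
    (hoptN : ∀ N, IsOptimalPortfolio (PN N : Measure (openSimplex n × openSimplex n))
      (πN N) (ΦN N)) :
    ∀ᵐ p ∂(surfaceMeasure n), 0 < f p → Tendsto (fun N => πN N p) atTop (𝓝 (π p)) := by
  obtain ⟨p₀, -⟩ :=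
    nonempty_of_isProbabilityMeasure (P : Measure (openSimplex n × openSimplex n))
  have hgen := hopt.1.mem_generators p₀
  have hS : MeasurableSet {p | 0 < f p} := measurableSet_lt measurable_const hf
  filter_upwards [ae_generators_subsingleton fun p => ⟨_, hgen p⟩,
    ae_mem_posTangentConeAt_image_val hS] with p huniq hcone hfp
  refine tendsto_of_subseq_tendsto fun ns hns => ?_
  obtain ⟨s, hs, φ', hφ', w, hw, hlim⟩ := exists_subseq_tendsto_of_mem_generators
    (fun k => (hoptN (ns k)).1.mem_generators p₀) (fun k => sub_self _) p
  have hmem : ∀ᵐ q ∂surfaceMeasure n, 0 < f q → π q ∈ generators φ' q :=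
    ae_mem_generators_of_tendsto_optimal hK (fun k => hPNK (ns (s k)))
      (hconv.comp (hns.comp hs.tendsto_atTop)) hf hPf hPκ hsupp hopt (fun k => hoptN _) hφ'
  have hnull : surfaceMeasure n ({q | 0 < f q} \ {q | π q ∈ generators φ' q}) = 0 :=
    ae_le_set.1 hmem
  have heq : π p = w := eq_of_forall_mem_posTangentConeAt (hgen p).1
    (continuousAt_of_generators_subsingleton hgen huniq) (hcone hfp _ hnull) hw
  exact ⟨s, heq ▸ hlim⟩

theorem theorem5p5 (n : ℕ) (hn : 2 ≤ n)
    (K : Set (openSimplex n)) (hK : IsCompact K)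
    (P : ProbabilityMeasure (openSimplex n × openSimplex n))
    (hPK : (P : Measure (openSimplex n × openSimplex n)) (K ×ˢ K)ᶜ = 0)
    (hPac : IsAbsCont (P : Measure (openSimplex n × openSimplex n)))
    (f : openSimplex n → ℝ≥0∞) (hf : Measurable f)
    (hPf : (P : Measure (openSimplex n × openSimplex n)).fst = (surfaceMeasure n).withDensity f)
    (κ : Kernel (openSimplex n) (openSimplex n)) [IsMarkovKernel κ]
    (hPκ : (P : Measure (openSimplex n × openSimplex n)) =
      (P : Measure (openSimplex n × openSimplex n)).fst ⊗ₘ κ)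
    (hsupp : SupportCondition f κ)
    (π : openSimplex n → EuclideanSpace ℝ (Fin n)) (Φ : EuclideanSpace ℝ (Fin n) → ℝ)
    (hopt : IsOptimalPortfolio (P : Measure (openSimplex n × openSimplex n)) π Φ)
    (PN : ℕ → ProbabilityMeasure (openSimplex n × openSimplex n))
    (hPNK : ∀ N, (PN N : Measure (openSimplex n × openSimplex n)) (K ×ˢ K)ᶜ = 0)
    (hPNda : ∀ N, IsDiscreteMeasure (PN N : Measure (openSimplex n × openSimplex n)) ∨
      IsAbsCont (PN N : Measure (openSimplex n × openSimplex n)))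
    (hconv : Tendsto PN atTop (𝓝 P))
    (πN : ℕ → openSimplex n → EuclideanSpace ℝ (Fin n))
    (ΦN : ℕ → EuclideanSpace ℝ (Fin n) → ℝ)
    (hoptN : ∀ N, IsOptimalPortfolio (PN N : Measure (openSimplex n × openSimplex n))
      (πN N) (ΦN N)) :
    ∀ᵐ p ∂(surfaceMeasure n), 0 < f p → Tendsto (fun N => πN N p) atTop (𝓝 (π p)) :=
  theorem5p5_general n K hK P f hf hPf κ hPκ hsupp π Φ hopt PN hPNK hconv πN ΦN hoptN
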